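/- For positive integers $n$ and $d$, let $P(n,d)$ be the maximum size of an $(n,d)$ permutation array, i.e. of a set $C$ of permutations of $\{0,1,\dots,n-1\}$ such that any two distinct members of $C$ differ in at least $d$ positions (are at Hamming distance at least $d$). Let $V(n,d-1)=\sum_{i=0}^{d-1}\binom{n}{i}D_i$, where $D_i$ is the number of derangements (fixed-point-free permutations) of $i$ points and $D_0=1$; this is the number of permutations of $\{0,\dots,n-1\}$ at Hamming distance at most $d-1$ from a given one. Let $\alpha$ be a constant with $0<\alpha<1$. Then there is a constant $c>0$, depending only on $\alpha$, such that for every integer $n\ge 1$ and for $d=n^{\alpha}$, rounded to an integer in either direction (that is, for $d=\lfloor n^{\alpha}\rfloor$ and for $d=\lceil n^{\alpha}\rceil$), \[ P(n,d)\ \ge\ c\,\frac{n!}{V(n,d-1)}\,\log_2 V(n,d-1). \] -/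

import Mathlib

/-- `C` is an `(n, d)` permutation array: a set of permutations of `Fin n` any two distinct
members of which are at Hamming distance at least `d`. -/
def IsPermArray (n d : ℕ) (C : Finset (Equiv.Perm (Fin n))) : Prop :=
  ∀ x ∈ C, ∀ y ∈ C, x ≠ y → d ≤ hammingDist (⇑x) (⇑y)

open Classical in
/-- `P(n, d)`: the maximum size of an `(n, d)` permutation array. The maximum is over a
non-empty finite family, since the empty set is an `(n, d)` permutation array. -/
noncomputable def maxPermArray (n d : ℕ) : ℕ :=
  ((Finset.univ : Finset (Finset (Equiv.Perm (Fin n)))).filter (IsPermArray n d)).sup Finset.card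

/-- `V(n, r) = ∑_{i = 0}^{r} (n choose i) D_i`, where `D_i` is the number of derangements of
`i` points: the number of permutations of `n` points within Hamming distance `r` of a fixed one. -/
def permBallVolume (n r : ℕ) : ℕ :=
  ∑ i ∈ Finset.range (r + 1), n.choose i * numDerangements i

/-! Put `k = d - 1` and join distinct permutations at distance at most `k`; the independent sets of
this graph are the `(n, d)` arrays. Degrees are at most `Δ = V(n, k)`, so a greedy choice gives only
`n! / Δ`. The factor `log Δ` comes from local sparsity: each neighbourhood contains at most `Δ ^ (2
- 2η)` ordered adjacent pairs, for some `η > 0` depending only on `α`.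

Sparsity is used through the hard-core model at fugacity `t = Δ ^ (η - 1)`
(`exists_isIndepSet_of_locally_sparse`). For each vertex `v`, `Δ` times the probability that `v` is
occupied plus the expected number of its occupied neighbours is at least of order `η log Δ`. The sum
of these quantities over `v` is at most `2Δ` times the mean size of a random independent set.

Sparsity is proved by counting (`card_pairs_ball_le`). A permutation `u` moving `a` points can be
chosen in at most `n ^ a` ways, and the balls of radius `k` around `1` and `u` share about `n ^ (k -
(1 - β) a)` elements, up to a factor exponential in `k`, when `k ≤ n ^ β`. The worst case `a = k`
gives about `n ^ ((1 + β) k)` pairs, whereas `Δ ^ 2` is about `n ^ (2k)`. -/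

/-! ### The hard-core model on locally sparse graphs -/

namespace SimpleGraph

variable {V : Type*} [DecidableEq V] (G : SimpleGraph V)

open Classical in
/-- The independent subsets of `S`. -/
noncomputable def indepSubsets (S : Finset V) : Finset (Finset V) :=
  S.powerset.filter fun I => G.IsIndepSet (I : Set V)

/-- The partition function of the hard-core model on `S` at fugacity `t`. -/
noncomputable def hardCoreSum (t : ℝ) (S : Finset V) : ℝ :=
  ∑ I ∈ G.indepSubsets S, t ^ I.card

variable {G}

lemma mem_indepSubsets {S I : Finset V} :
    I ∈ G.indepSubsets S ↔ I ⊆ S ∧ ∀ x ∈ I, ∀ y ∈ I, ¬ G.Adj x y := by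
  classical
  simp only [indepSubsets, Finset.mem_filter, Finset.mem_powerset]
  refine and_congr_right fun _ => ⟨fun h x hx y hy hxy => h hx hy hxy.ne hxy,
    fun h x hx y hy _ => h x hx y hy⟩

lemma empty_mem_indepSubsets (S : Finset V) : ∅ ∈ G.indepSubsets S := by
  simp [mem_indepSubsets]

lemma one_le_hardCoreSum {t : ℝ} (ht : 0 ≤ t) (S : Finset V) : 1 ≤ G.hardCoreSum t S := by
  have := Finset.single_le_sum (f := fun I : Finset V => t ^ I.card)
    (fun I _ => pow_nonneg ht _) (empty_mem_indepSubsets (G := G) S)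
  simpa [hardCoreSum] using this

lemma hardCoreSum_le_exp {t : ℝ} (ht : 0 ≤ t) (S : Finset V) :
    G.hardCoreSum t S ≤ Real.exp (t * S.card) := by
  classical
  calc G.hardCoreSum t S ≤ ∑ I ∈ S.powerset, t ^ I.card :=
        Finset.sum_le_sum_of_subset_of_nonneg (Finset.filter_subset _ _)
          fun I _ _ => pow_nonneg ht _
    _ = (t + 1) ^ S.card := by
        have := Finset.sum_pow_mul_eq_add_pow t 1 S
        simpa using this
    _ ≤ Real.exp t ^ S.card := by
        gcongr
        exact Real.add_one_le_exp t
    _ = Real.exp (t * S.card) := by rw [← Real.exp_nat_mul, mul_comm]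

/-- Erasing `u` is injective on sets containing `u`, keeps independence and divides the weight by
`t`. -/
lemma sum_mem_indepSubsets_le {t : ℝ} (ht : 0 ≤ t) (S : Finset V) (u : V) :
    ∑ I ∈ (G.indepSubsets S).filter (u ∈ ·), t ^ I.card ≤ t * G.hardCoreSum t S := by
  have hinj : Set.InjOn (fun I : Finset V => I.erase u)
      ((G.indepSubsets S).filter (u ∈ ·) : Finset (Finset V)) := by
    intro I hI J hJ h
    simp only [Finset.coe_filter, Set.mem_ofPred_eq] at hI hJ
    rw [← Finset.insert_erase hI.2, ← Finset.insert_erase hJ.2]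
    exact congrArg _ h
  calc ∑ I ∈ (G.indepSubsets S).filter (u ∈ ·), t ^ I.card
      = ∑ I ∈ (G.indepSubsets S).filter (u ∈ ·), t * t ^ (I.erase u).card := by
        refine Finset.sum_congr rfl fun I hI => ?_
        rw [← Finset.card_erase_add_one (Finset.mem_filter.1 hI).2, pow_succ']
    _ = t * ∑ J ∈ ((G.indepSubsets S).filter (u ∈ ·)).image (·.erase u), t ^ J.card := by
        rw [Finset.sum_image hinj, Finset.mul_sum]
    _ ≤ t * G.hardCoreSum t S := by
        refine mul_le_mul_of_nonneg_left ?_ ht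
        refine Finset.sum_le_sum_of_subset_of_nonneg ?_ fun I _ _ => pow_nonneg ht _
        intro J hJ
        obtain ⟨I, hI, rfl⟩ := Finset.mem_image.1 hJ
        have hI := mem_indepSubsets.1 (Finset.mem_filter.1 hI).1
        exact mem_indepSubsets.2 ⟨(Finset.erase_subset _ _).trans hI.1, fun x hx y hy =>
          hI.2 x (Finset.mem_of_mem_erase hx) y (Finset.mem_of_mem_erase hy)⟩

-- Adding `u` to an independent set that misses the closed neighbourhood `B` of `u` in `S` keeps
-- independence. By a union bound over `B`, using the upper bound on occupation, the sets meeting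
-- `B` carry at most a fraction `t * |B|` of the total weight.
open Classical in
lemma le_sum_mem_indepSubsets {t : ℝ} (ht : 0 ≤ t) {S : Finset V} {u : V} (hu : u ∈ S) :
    t * (1 - t * ((S.filter (G.Adj u)).card + 1)) * G.hardCoreSum t S ≤
      ∑ I ∈ (G.indepSubsets S).filter (u ∈ ·), t ^ I.card := by
  set B := insert u (S.filter (G.Adj u)) with hB
  set A := (G.indepSubsets S).filter (fun I => Disjoint I B) with hA
  have huA : ∀ I ∈ A, u ∉ I := fun I hI h =>
    Finset.disjoint_left.1 (Finset.mem_filter.1 hI).2 h (Finset.mem_insert_self _ _)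
  have h1 : t * ∑ I ∈ A, t ^ I.card ≤
      ∑ I ∈ (G.indepSubsets S).filter (u ∈ ·), t ^ I.card := by
    have hinj : Set.InjOn (fun I : Finset V => insert u I) (A : Set (Finset V)) := by
      intro I hI J hJ h
      rw [← Finset.erase_insert (huA I hI), ← Finset.erase_insert (huA J hJ)]
      exact congrArg (·.erase u) h
    calc t * ∑ I ∈ A, t ^ I.card = ∑ I ∈ A, t ^ (insert u I).card := by
          rw [Finset.mul_sum]
          refine Finset.sum_congr rfl fun I hI => ?_
          rw [Finset.card_insert_of_notMem (huA I hI), pow_succ']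
      _ = ∑ J ∈ A.image (insert u), t ^ J.card :=
          (Finset.sum_image (f := fun J : Finset V => t ^ J.card) hinj).symm
      _ ≤ _ := by
          refine Finset.sum_le_sum_of_subset_of_nonneg ?_ fun I _ _ => pow_nonneg ht _
          intro J hJ
          obtain ⟨I, hI, rfl⟩ := Finset.mem_image.1 hJ
          obtain ⟨hI, hd⟩ := Finset.mem_filter.1 hI
          obtain ⟨hs, hi⟩ := mem_indepSubsets.1 hI
          have hn : ∀ x ∈ I, ¬ G.Adj u x := fun x hx hux =>
            Finset.disjoint_left.1 hd hx
              (Finset.mem_insert_of_mem (Finset.mem_filter.2 ⟨hs hx, hux⟩))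
          refine Finset.mem_filter.2 ⟨mem_indepSubsets.2 ⟨Finset.insert_subset hu hs, ?_⟩,
            Finset.mem_insert_self _ _⟩
          intro x hx y hy
          rcases Finset.mem_insert.1 hx with hx' | hx' <;>
            rcases Finset.mem_insert.1 hy with hy' | hy'
          · rw [hx', hy']
            exact G.irrefl
          · rw [hx']
            exact hn y hy'
          · rw [hy']
            exact fun h => hn x hx' h.symm
          · exact hi x hx' y hy'
  have h2 : G.hardCoreSum t S ≤ ∑ I ∈ A, t ^ I.card +
      ∑ w ∈ B, ∑ I ∈ (G.indepSubsets S).filter (w ∈ ·), t ^ I.card := by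
    rw [hardCoreSum, ← Finset.sum_filter_add_sum_filter_not (G.indepSubsets S)
      (fun I => Disjoint I B)]
    refine add_le_add le_rfl ?_
    simp_rw [Finset.sum_filter]
    rw [Finset.sum_comm]
    refine Finset.sum_le_sum fun I _ => ?_
    have hnn : ∀ w ∈ B, 0 ≤ if w ∈ I then t ^ I.card else (0 : ℝ) := fun w _ => by
      split_ifs
      · exact pow_nonneg ht _
      · exact le_rfl
    by_cases h : Disjoint I B
    · simpa [h] using Finset.sum_nonneg hnn
    · obtain ⟨w, hwI, hwB⟩ := Finset.not_disjoint_iff.1 h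
      have := Finset.single_le_sum hnn hwB
      rw [if_pos hwI] at this
      simpa only [h, not_false_eq_true, if_true] using this
  have h3 : ∑ w ∈ B, ∑ I ∈ (G.indepSubsets S).filter (w ∈ ·), t ^ I.card ≤
      ((S.filter (G.Adj u)).card + 1) * (t * G.hardCoreSum t S) := by
    refine (Finset.sum_le_sum fun w _ => sum_mem_indepSubsets_le ht S w).trans ?_
    rw [Finset.sum_const, nsmul_eq_mul]
    have hZ : 0 ≤ t * G.hardCoreSum t S :=
      mul_nonneg ht (zero_le_one.trans (one_le_hardCoreSum ht S))
    refine mul_le_mul_of_nonneg_right ?_ hZ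
    exact_mod_cast Finset.card_insert_le _ _
  refine le_trans ?_ h1
  rw [mul_assoc]
  refine mul_le_mul_of_nonneg_left ?_ ht
  nlinarith

lemma sum_card_mul_eq (f : Finset V → ℝ) (A : Finset (Finset V)) {S : Finset V}
    (hA : ∀ I ∈ A, I ⊆ S) :
    ∑ I ∈ A, (I.card : ℝ) * f I = ∑ u ∈ S, ∑ I ∈ A.filter (u ∈ ·), f I := by
  simp_rw [Finset.sum_filter]
  rw [Finset.sum_comm]
  refine Finset.sum_congr rfl fun I hI => ?_
  rw [← Finset.sum_filter, Finset.sum_const, nsmul_eq_mul, Finset.filter_mem_eq_inter,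
    Finset.inter_eq_right.2 (hA I hI)]

open Classical in
lemma le_sum_card_indepSubsets {t : ℝ} (ht : 0 ≤ t) (S : Finset V) :
    t * (S.card - t * (((S ×ˢ S).filter fun p => G.Adj p.1 p.2).card + S.card)) *
      G.hardCoreSum t S ≤ ∑ I ∈ G.indepSubsets S, (I.card : ℝ) * t ^ I.card := by
  rw [sum_card_mul_eq (fun I => t ^ I.card) _ fun I hI => (mem_indepSubsets.1 hI).1]
  refine le_trans (le_of_eq ?_) (Finset.sum_le_sum fun u hu => le_sum_mem_indepSubsets ht hu)
  have : (((S ×ˢ S).filter fun p : V × V => G.Adj p.1 p.2).card : ℝ) =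
      ∑ u ∈ S, ((S.filter (G.Adj u)).card : ℝ) := by
    simp_rw [Finset.card_filter]
    rw [Finset.sum_product]
    push_cast
    rfl
  rw [this, ← Finset.sum_mul, ← Finset.mul_sum]
  simp only [Finset.sum_sub_distrib, ← Finset.mul_sum, Finset.sum_add_distrib, Finset.sum_const,
    nsmul_eq_mul, mul_one]

open Classical in
/-- If few pairs in `S` are adjacent, then in the hard-core model on a star with leaves in `S`
either the centre or many leaves are likely to be occupied. -/
lemma mul_hardCoreSum_add_le {Δ η : ℝ} (hη : 0 < η) (hη' : η ≤ 1 / 2) (hΔ : 1 < Δ)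
    (hL : 4 ≤ η * Real.log Δ) (S : Finset V)
    (hS : (((S ×ˢ S).filter fun p : V × V => G.Adj p.1 p.2).card : ℝ) ≤ Δ ^ (2 - 2 * η)) :
    η * Real.log Δ / 16 * (Δ ^ (η - 1) + G.hardCoreSum (Δ ^ (η - 1)) S) ≤
      Δ * Δ ^ (η - 1) +
        ∑ I ∈ G.indepSubsets S, (I.card : ℝ) * (Δ ^ (η - 1)) ^ I.card := by
  set t : ℝ := Δ ^ (η - 1) with ht_def
  set L := Real.log Δ with hL_def
  set Z := G.hardCoreSum t S with hZ_def
  have hΔ0 : 0 < Δ := zero_lt_one.trans hΔ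
  have ht : 0 < t := Real.rpow_pos_of_pos hΔ0 _
  have hZ1 : 1 ≤ Z := one_le_hardCoreSum ht.le S
  have hexp : ∀ y : ℝ, Δ ^ y = Real.exp (y * L) := fun y => by
    rw [Real.rpow_def_of_pos hΔ0, mul_comm]
  have hLpos : 0 < L := Real.log_pos hΔ
  have ht4 : t ≤ 1 / 4 := by
    have h4 : (4 : ℝ) ≤ Real.exp (η * L) := by linarith [Real.add_one_le_exp (η * L)]
    have h1 : t * Real.exp (η * L) ≤ 1 := by
      rw [ht_def, hexp, ← Real.exp_add, Real.exp_le_one_iff]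
      nlinarith
    nlinarith
  have hΔt : Δ * t = Real.exp (η * L) := by
    rw [ht_def, hexp, ← Real.exp_log hΔ0, ← hL_def, ← Real.exp_add]
    congr 1
    ring
  have hsum0 : 0 ≤ ∑ I ∈ G.indepSubsets S, (I.card : ℝ) * t ^ I.card :=
    Finset.sum_nonneg fun I _ => by positivity
  -- If `t|S|` is small, then `Z ≤ exp (ηL / 2)`, and the centre's term `Δt = exp (ηL)` suffices
  -- alone. Otherwise the leaves suffice: `t` is chosen so that `t ^ 2 * Δ ^ (2 - 2η) = 1`, so
  -- adjacent pairs cost at most `1`, while `t|S| > 2`.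
  rcases le_or_gt (t * S.card) (η / 2 * L) with hm | hm
  · have hZ : Z ≤ Real.exp (η / 2 * L) :=
      (hardCoreSum_le_exp ht.le S).trans (Real.exp_le_exp.2 hm)
    have h2 : Real.exp (η * L) = Real.exp (η / 2 * L) * Real.exp (η / 2 * L) := by
      rw [← Real.exp_add]
      congr 1
      ring
    have h3 : η / 2 * L ≤ Real.exp (η / 2 * L) := by
      linarith [Real.add_one_le_exp (η / 2 * L)]
    rw [hΔt, h2]
    have h4 : η * L / 16 * (t + Z) ≤
        Real.exp (η / 2 * L) * Real.exp (η / 2 * L) := by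
      have : t + Z ≤ 2 * Real.exp (η / 2 * L) := by linarith
      calc η * L / 16 * (t + Z) ≤ (Real.exp (η / 2 * L) / 8) * (2 * Real.exp (η / 2 * L)) :=
            mul_le_mul (by linarith) this (by linarith) (by positivity)
        _ ≤ _ := by nlinarith [Real.exp_pos (η / 2 * L)]
    linarith
  · have hZ := le_sum_card_indepSubsets (G := G) ht.le S
    set e : ℝ := (((S ×ˢ S).filter fun p : V × V => G.Adj p.1 p.2).card : ℝ) with he
    have hte : t * (t * e) ≤ 1 := by
      calc t * (t * e) ≤ t * (t * Δ ^ (2 - 2 * η)) := by gcongr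
        _ = 1 := by
          rw [ht_def, hexp, hexp, ← Real.exp_add, ← Real.exp_add, Real.exp_eq_one_iff]
          ring
    have hm0 : (0 : ℝ) ≤ S.card := Nat.cast_nonneg _
    have h5 : t * (S.card : ℝ) / 4 ≤ t * (S.card - t * (e + S.card)) := by
      nlinarith [mul_nonneg ht.le hm0]
    have h6 : t * (S.card : ℝ) / 4 * Z ≤ ∑ I ∈ G.indepSubsets S, (I.card : ℝ) * t ^ I.card :=
      (mul_le_mul_of_nonneg_right h5 (by linarith)).trans hZ
    have h7 : η * L / 16 * (t + Z) ≤ t * (S.card : ℝ) / 4 * Z := by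
      have : t + Z ≤ 2 * Z := by linarith
      calc η * L / 16 * (t + Z) ≤ (t * (S.card : ℝ) / 8) * (2 * Z) :=
            mul_le_mul (by linarith) this (by linarith) (by positivity)
        _ = _ := by ring
    nlinarith [mul_nonneg hΔ0.le ht.le]

-- Markov property: once the part `H` outside the closed neighbourhood of `v` is fixed, what remains
-- is the model on a star with centre `v`, whose leaves are the neighbours of `v` not blocked by
-- `H`.
open Classical in
lemma fiber_eq [Fintype V] {v : V} {H : Finset V} (hH : H ∈ G.indepSubsets Finset.univ)
    (hv : v ∉ H) (hN : ∀ x ∈ H, ¬ G.Adj v x) :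
    ((G.indepSubsets Finset.univ).filter fun I => (I.filter fun x => x ≠ v ∧ ¬ G.Adj v x) = H) =
      insert (insert v H) ((G.indepSubsets
        (Finset.univ.filter fun u => G.Adj v u ∧ ∀ x ∈ H, ¬ G.Adj u x)).image (H ∪ ·)) := by
  have hHi := (mem_indepSubsets.1 hH).2
  ext I
  simp only [Finset.mem_filter, Finset.mem_insert, Finset.mem_image]
  constructor
  · rintro ⟨hI, rfl⟩
    have hIi := (mem_indepSubsets.1 hI).2
    by_cases hvI : v ∈ I
    · left
      ext x
      simp only [Finset.mem_insert, Finset.mem_filter]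
      constructor
      · intro hx
        by_cases hxv : x = v
        · exact Or.inl hxv
        · exact Or.inr ⟨hx, hxv, hIi v hvI x hx⟩
      · rintro (rfl | hx)
        · exact hvI
        · exact hx.1
    · right
      refine ⟨I.filter (G.Adj v), mem_indepSubsets.2 ⟨?_, ?_⟩, ?_⟩
      · intro u hu
        have hu := Finset.mem_filter.1 hu
        simp only [Finset.mem_filter, Finset.mem_univ, true_and]
        exact ⟨hu.2, fun x hx => hIi u hu.1 x hx.1⟩
      · exact fun x hx y hy => hIi x (Finset.mem_filter.1 hx).1 y (Finset.mem_filter.1 hy).1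
      · ext x
        simp only [Finset.mem_union, Finset.mem_filter]
        constructor
        · rintro (h | h) <;> exact h.1
        · intro hx
          by_cases hvx : G.Adj v x
          · exact Or.inr ⟨hx, hvx⟩
          · exact Or.inl ⟨hx, fun h => hvI (h ▸ hx), hvx⟩
  · rintro (rfl | ⟨J, hJ, rfl⟩)
    · refine ⟨mem_indepSubsets.2 ⟨Finset.subset_univ _, ?_⟩, ?_⟩
      · intro x hx y hy
        rcases Finset.mem_insert.1 hx with hx' | hx' <;>
          rcases Finset.mem_insert.1 hy with hy' | hy'
        · rw [hx', hy']
          exact G.irrefl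
        · rw [hx']
          exact hN y hy'
        · rw [hy']
          exact fun h => hN x hx' h.symm
        · exact hHi x hx' y hy'
      · ext x
        simp only [Finset.mem_filter, Finset.mem_insert]
        constructor
        · rintro ⟨h | h, h1, h2⟩
          · exact absurd h h1
          · exact h
        · exact fun h => ⟨Or.inr h, fun hx => hv (hx ▸ h), hN x h⟩
    · obtain ⟨hJs, hJi⟩ := mem_indepSubsets.1 hJ
      have hJs' : ∀ u ∈ J, G.Adj v u ∧ ∀ x ∈ H, ¬ G.Adj u x := fun u hu => by
        simpa using hJs hu
      refine ⟨mem_indepSubsets.2 ⟨Finset.subset_univ _, ?_⟩, ?_⟩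
      · intro x hx y hy
        rcases Finset.mem_union.1 hx with hx' | hx' <;>
          rcases Finset.mem_union.1 hy with hy' | hy'
        · exact hHi x hx' y hy'
        · exact fun h => (hJs' y hy').2 x hx' h.symm
        · exact (hJs' x hx').2 y hy'
        · exact hJi x hx' y hy'
      · ext x
        simp only [Finset.mem_filter, Finset.mem_union]
        constructor
        · rintro ⟨h | h, -, h2⟩
          · exact h
          · exact absurd (hJs' x h).1 h2
        · exact fun h => ⟨Or.inl h, fun hx => hv (hx ▸ h), hN x h⟩

open Classical in
lemma sum_fiber [Fintype V] {v : V} {H : Finset V} (hH : H ∈ G.indepSubsets Finset.univ)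
    (hv : v ∉ H) (hN : ∀ x ∈ H, ¬ G.Adj v x) (g : Finset V → ℝ) :
    ∑ I ∈ (G.indepSubsets Finset.univ).filter
        (fun I => (I.filter fun x => x ≠ v ∧ ¬ G.Adj v x) = H), g I =
      g (insert v H) + ∑ J ∈ G.indepSubsets
        (Finset.univ.filter fun u => G.Adj v u ∧ ∀ x ∈ H, ¬ G.Adj u x), g (H ∪ J) := by
  have hJ : ∀ J ∈ G.indepSubsets
      (Finset.univ.filter fun u => G.Adj v u ∧ ∀ x ∈ H, ¬ G.Adj u x), ∀ u ∈ J, G.Adj v u :=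
    fun J hJ u hu => (Finset.mem_filter.1 ((mem_indepSubsets.1 hJ).1 hu)).2.1
  rw [fiber_eq hH hv hN, Finset.sum_insert, Finset.sum_image]
  · intro J hJ1 K hK1 h
    have key : ∀ J ∈ G.indepSubsets
        (Finset.univ.filter fun u => G.Adj v u ∧ ∀ x ∈ H, ¬ G.Adj u x),
        (H ∪ J).filter (G.Adj v) = J := fun J hJ1 => by
      rw [Finset.filter_union, Finset.filter_false_of_mem hN,
        Finset.filter_true_of_mem (hJ J hJ1), Finset.empty_union]
    rw [← key J hJ1, ← key K hK1]
    exact congrArg (Finset.filter (G.Adj v)) h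
  · intro h
    obtain ⟨J, hJ1, h⟩ := Finset.mem_image.1 h
    have : v ∈ H ∪ J := by
      rw [h]
      exact Finset.mem_insert_self _ _
    rcases Finset.mem_union.1 this with h | h
    · exact hv h
    · exact G.irrefl (hJ J hJ1 v h)

-- The star estimate holds conditionally on each `H`; summing over `H` removes the conditioning.
open Classical in
lemma mul_hardCoreSum_le_sum_local [Fintype V] {Δ η : ℝ} (hη : 0 < η) (hη' : η ≤ 1 / 2)
    (hΔ : 1 < Δ) (hL : 4 ≤ η * Real.log Δ) (v : V)
    (hv : (Finset.univ.filter fun p : V × V =>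
      G.Adj v p.1 ∧ G.Adj v p.2 ∧ G.Adj p.1 p.2).card ≤ Δ ^ (2 - 2 * η)) :
    η * Real.log Δ / 16 * G.hardCoreSum (Δ ^ (η - 1)) Finset.univ ≤
      ∑ I ∈ G.indepSubsets Finset.univ, (Δ ^ (η - 1)) ^ I.card *
        ((if v ∈ I then Δ else 0) + ((I.filter (G.Adj v)).card : ℝ)) := by
  set t : ℝ := Δ ^ (η - 1) with ht_def
  have ht : 0 < t := Real.rpow_pos_of_pos (zero_lt_one.trans hΔ) _
  have hmaps : ∀ I ∈ G.indepSubsets Finset.univ,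
      (I.filter fun x => x ≠ v ∧ ¬ G.Adj v x) ∈
        (G.indepSubsets Finset.univ).filter fun H => v ∉ H ∧ ∀ x ∈ H, ¬ G.Adj v x := by
    intro I hI
    refine Finset.mem_filter.2 ⟨mem_indepSubsets.2 ⟨Finset.subset_univ _, ?_⟩, ?_, ?_⟩
    · exact fun x hx y hy => (mem_indepSubsets.1 hI).2 x (Finset.mem_filter.1 hx).1 y
        (Finset.mem_filter.1 hy).1
    · simp
    · exact fun x hx => (Finset.mem_filter.1 hx).2.2
  rw [hardCoreSum, ← Finset.sum_fiberwise_of_maps_to hmaps, Finset.mul_sum,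
    ← Finset.sum_fiberwise_of_maps_to hmaps]
  refine Finset.sum_le_sum fun H hH => ?_
  obtain ⟨hH, hvH, hN⟩ := Finset.mem_filter.1 hH
  rw [sum_fiber hH hvH hN, sum_fiber hH hvH hN]
  set M := Finset.univ.filter fun u => G.Adj v u ∧ ∀ x ∈ H, ¬ G.Adj u x with hM
  have hJ : ∀ J ∈ G.indepSubsets M, ∀ u ∈ J, G.Adj v u :=
    fun J hJ u hu => (Finset.mem_filter.1 ((mem_indepSubsets.1 hJ).1 hu)).2.1
  have hcard : ∀ J ∈ G.indepSubsets M, (H ∪ J).card = H.card + J.card := fun J hJ1 =>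
    Finset.card_union_of_disjoint (Finset.disjoint_left.2 fun x hx hx' => hN x hx (hJ J hJ1 x hx'))
  have e1 : ∑ J ∈ G.indepSubsets M, t ^ (H ∪ J).card = t ^ H.card * G.hardCoreSum t M := by
    rw [hardCoreSum, Finset.mul_sum]
    exact Finset.sum_congr rfl fun J hJ => by rw [hcard J hJ, pow_add]
  have e2 : ∑ J ∈ G.indepSubsets M, t ^ (H ∪ J).card *
      ((if v ∈ H ∪ J then Δ else 0) + (((H ∪ J).filter (G.Adj v)).card : ℝ)) =
      t ^ H.card * ∑ J ∈ G.indepSubsets M, (J.card : ℝ) * t ^ J.card := by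
    rw [Finset.mul_sum]
    refine Finset.sum_congr rfl fun J hJ1 => ?_
    have hvJ : v ∉ H ∪ J := fun h => (Finset.mem_union.1 h).elim hvH
      fun h => G.irrefl (hJ J hJ1 v h)
    rw [hcard J hJ1, pow_add, if_neg hvJ, Finset.filter_union, Finset.filter_false_of_mem hN,
      Finset.filter_true_of_mem (hJ J hJ1), Finset.empty_union]
    ring
  have e3 : (insert v H).filter (G.Adj v) = ∅ := by
    refine Finset.filter_false_of_mem fun x hx => ?_
    rcases Finset.mem_insert.1 hx with h | h
    · rw [h]
      exact G.irrefl
    · exact hN x h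
  rw [e1, e2, e3, Finset.card_insert_of_notMem hvH, if_pos (Finset.mem_insert_self _ _)]
  have key := mul_hardCoreSum_add_le (G := G) hη hη' hΔ hL M (by
    refine le_trans ?_ hv
    norm_cast
    refine Finset.card_le_card fun p hp => ?_
    simp only [hM, Finset.mem_filter, Finset.mem_product, Finset.mem_univ, true_and] at hp ⊢
    exact ⟨hp.1.1.1, hp.1.2.1, hp.2⟩)
  have := mul_le_mul_of_nonneg_left key (pow_nonneg ht.le H.card)
  rw [← ht_def] at this
  calc _ = t ^ H.card * (η * Real.log Δ / 16 * (t + G.hardCoreSum t M)) := by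
        rw [pow_succ]
        ring
    _ ≤ _ := this
    _ = _ := by
        rw [pow_succ]
        simp only [Finset.card_empty, Nat.cast_zero]
        ring

open Classical in
/-- A graph with maximum degree at most `Δ` and few triangles at each vertex has an
independent set larger by a factor of order `log Δ` than the greedy bound. -/
theorem exists_isIndepSet_of_locally_sparse [Fintype V] {Δ η : ℝ} (hη : 0 < η)
    (hη' : η ≤ 1 / 2) (hΔ : 1 < Δ) (hL : 4 ≤ η * Real.log Δ)
    (hdeg : ∀ v, ((Finset.univ.filter (G.Adj v)).card : ℝ) ≤ Δ)
    (hloc : ∀ v, ((Finset.univ.filter fun p : V × V =>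
      G.Adj v p.1 ∧ G.Adj v p.2 ∧ G.Adj p.1 p.2).card : ℝ) ≤ Δ ^ (2 - 2 * η)) :
    ∃ I : Finset V, G.IsIndepSet (I : Set V) ∧
      Fintype.card V * (η * Real.log Δ) / (32 * Δ) ≤ I.card := by
  set t : ℝ := Δ ^ (η - 1) with ht_def
  have hΔ0 : 0 < Δ := zero_lt_one.trans hΔ
  have ht : 0 < t := Real.rpow_pos_of_pos hΔ0 _
  have hZ := one_le_hardCoreSum (G := G) ht.le Finset.univ
  obtain ⟨I₀, hI₀, hmax⟩ := Finset.exists_max_image (G.indepSubsets Finset.univ) Finset.card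
    ⟨∅, empty_mem_indepSubsets _⟩
  refine ⟨I₀, (Finset.mem_filter.1 hI₀).2, ?_⟩
  have h1 := Finset.sum_le_sum fun v (_ : v ∈ Finset.univ) =>
    mul_hardCoreSum_le_sum_local (G := G) hη hη' hΔ hL v (hloc v)
  rw [Finset.sum_const, nsmul_eq_mul, Finset.card_univ, Finset.sum_comm] at h1
  -- Each `x ∈ I` contributes `Δ` at `v = x` and at most `Δ` through its neighbours.
  have h2 : ∀ I ∈ G.indepSubsets Finset.univ, ∑ v, t ^ I.card *
      ((if v ∈ I then Δ else 0) + ((I.filter (G.Adj v)).card : ℝ)) ≤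
      t ^ I.card * (2 * Δ * I₀.card) := by
    intro I hI
    rw [← Finset.mul_sum]
    refine mul_le_mul_of_nonneg_left ?_ (pow_nonneg ht.le _)
    rw [Finset.sum_add_distrib]
    have a1 : ∑ v, (if v ∈ I then Δ else 0) = I.card * Δ := by simp
    have a2 : ∑ v, ((I.filter (G.Adj v)).card : ℝ) ≤ I.card * Δ := by
      calc ∑ v, ((I.filter (G.Adj v)).card : ℝ)
          = ∑ x ∈ I, ((Finset.univ.filter (G.Adj x)).card : ℝ) := by
            simp_rw [Finset.card_filter]
            push_cast
            rw [Finset.sum_comm]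
            simp_rw [G.adj_comm]
        _ ≤ ∑ x ∈ I, Δ := Finset.sum_le_sum fun x _ => hdeg x
        _ = I.card * Δ := by simp
    have a3 : (I.card : ℝ) ≤ I₀.card := by exact_mod_cast hmax I hI
    nlinarith
  have h3 := h1.trans (Finset.sum_le_sum h2)
  rw [← Finset.sum_mul] at h3
  change _ ≤ G.hardCoreSum t Finset.univ * _ at h3
  rw [← ht_def] at h3
  have h4 : Fintype.card V * (η * Real.log Δ / 16) ≤ 2 * Δ * I₀.card := by
    refine le_of_mul_le_mul_right ?_ (zero_lt_one.trans_le hZ)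
    linarith
  rw [div_le_iff₀ (by positivity)]
  linarith

end SimpleGraph

/-! ### Permutations counted by support -/

namespace Equiv.Perm

variable {α : Type*} [Fintype α] [DecidableEq α]

/-- Left translation by the inverse of one such permutation carries the others to permutations
fixing every point outside `X`. -/
lemma card_filter_agree_off_le (X : Finset α) (g : α → α) :
    (Finset.univ.filter fun w : Equiv.Perm α => ∀ i, i ∉ X → w i = g i).card ≤
      X.card.factorial := by
  rcases Finset.eq_empty_or_nonempty
    (Finset.univ.filter fun w : Equiv.Perm α => ∀ i, i ∉ X → w i = g i) with h | ⟨w₀, h₀⟩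
  · simp [h]
  have h₀ := (Finset.mem_filter.1 h₀).2
  have h2 : (Finset.univ.filter fun f : Equiv.Perm α => ∀ i, i ∉ X → f i = i).card =
      X.card.factorial := by
    rw [← Fintype.card_subtype,
      ← Fintype.card_congr (Equiv.Perm.subtypeEquivSubtypePerm fun i => i ∈ X),
      Fintype.card_perm, Fintype.card_coe]
  rw [← h2]
  refine Finset.card_le_card_of_injOn (fun w => w₀⁻¹ * w) ?_ (mul_right_injective _).injOn
  intro w hw
  have hw := (Finset.mem_filter.1 hw).2
  refine Finset.mem_coe.2 (Finset.mem_filter.2 ⟨Finset.mem_univ _, fun i hi => ?_⟩)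
  rw [Equiv.Perm.mul_apply, Equiv.Perm.inv_eq_iff_eq, hw i hi, h₀ i hi]

lemma card_filter_support_eq (S : Finset α) :
    (Finset.univ.filter fun u : Equiv.Perm α => u.support = S).card =
      numDerangements S.card := by
  have h := Fintype.card_congr (derangements.subtypeEquiv fun i => i ∈ S)
  rw [card_derangements_eq_numDerangements, Fintype.card_coe] at h
  rw [h, Fintype.card_subtype]
  congr 1
  ext u
  simp only [Finset.mem_filter, Finset.mem_univ, true_and, Finset.ext_iff,
    Equiv.Perm.mem_support, Function.mem_fixedPoints, Function.IsFixedPt]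
  exact forall_congr' fun i => by tauto

lemma card_filter_card_support_eq (a : ℕ) :
    (Finset.univ.filter fun u : Equiv.Perm α => u.support.card = a).card =
      (Fintype.card α).choose a * numDerangements a := by
  have hmaps : ∀ u ∈ Finset.univ.filter fun u : Equiv.Perm α => u.support.card = a,
      u.support ∈ Finset.powersetCard a (Finset.univ : Finset α) := fun u hu =>
    Finset.mem_powersetCard.2 ⟨Finset.subset_univ _, (Finset.mem_filter.1 hu).2⟩
  rw [Finset.card_eq_sum_card_fiberwise hmaps, ← Finset.card_univ, ← Finset.card_powersetCard,
    ← smul_eq_mul, ← Finset.sum_const]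
  refine Finset.sum_congr rfl fun S hS => ?_
  have hS := (Finset.mem_powersetCard.1 hS).2
  rw [← hS, ← card_filter_support_eq S, Finset.filter_filter]
  congr 1
  ext u
  simp only [Finset.mem_filter, Finset.mem_univ, true_and]
  exact ⟨fun h => h.2, fun h => ⟨by rw [h], h⟩⟩

lemma card_filter_card_support_le_eq (k : ℕ) :
    (Finset.univ.filter fun u : Equiv.Perm α => u.support.card ≤ k).card =
      ∑ a ∈ Finset.range (k + 1), (Fintype.card α).choose a * numDerangements a := by
  have hmaps : ∀ u ∈ Finset.univ.filter fun u : Equiv.Perm α => u.support.card ≤ k,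
      u.support.card ∈ Finset.range (k + 1) := fun u hu =>
    Finset.mem_range_succ_iff.2 (Finset.mem_filter.1 hu).2
  rw [Finset.card_eq_sum_card_fiberwise hmaps]
  refine Finset.sum_congr rfl fun a ha => ?_
  rw [← card_filter_card_support_eq, Finset.filter_filter]
  congr 1
  ext u
  simp only [Finset.mem_filter, Finset.mem_univ, true_and]
  exact ⟨fun h => h.2, fun h => ⟨h ▸ Finset.mem_range_succ_iff.1 ha, h⟩⟩

lemma card_filter_card_support_eq_le_pow (a : ℕ) :
    (Finset.univ.filter fun u : Equiv.Perm α => u.support.card = a).card ≤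
      Fintype.card α ^ a := by
  rw [card_filter_card_support_eq]
  calc (Fintype.card α).choose a * numDerangements a
      ≤ (Fintype.card α).choose a * a.factorial := by
        refine Nat.mul_le_mul_left _ ?_
        have := Fintype.card_subtype_le (fun f : Equiv.Perm (Fin a) => f ∈ derangements (Fin a))
        have h2 := card_derangements_fin_eq_numDerangements (n := a)
        rw [Fintype.card_perm, Fintype.card_fin] at this
        exact h2.symm.trans_le this
    _ = (Fintype.card α).descFactorial a := by
        rw [Nat.descFactorial_eq_factorial_mul_choose, mul_comm]
    _ ≤ _ := Nat.descFactorial_le_pow _ _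

end Equiv.Perm

/-! ### Intersections of two Hamming balls -/

lemma Nat.choose_mul_factorial_add_le (n t f : ℕ) :
    n.choose t * (t + f).factorial ≤ n ^ t * (t + f) ^ f := by
  rw [← Nat.factorial_mul_ascFactorial, ← mul_assoc, mul_comm (n.choose t),
    ← Nat.descFactorial_eq_factorial_mul_choose]
  exact Nat.mul_le_mul (Nat.descFactorial_le_pow _ _) (Nat.ascFactorial_le_pow_add _ _)

/-- With `k ≤ n ^ β` the exponent is `t + β f ≤ k - a / 2 + (β - 1 / 2) f`. As `β ≥ 1 / 2`, the
worst case is `f = a`. -/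
lemma pow_mul_pow_le_rpow {n k t f a : ℕ} {β : ℝ} (hn : 1 ≤ n) (hβ : 1 / 2 ≤ β)
    (hk : (k : ℝ) ≤ (n : ℝ) ^ β) (hfa : f ≤ a) (h : 2 * t + f + a ≤ 2 * k) :
    (n : ℝ) ^ t * (k : ℝ) ^ f ≤ (n : ℝ) ^ ((k : ℝ) - (1 - β) * a) := by
  have hn' : (1 : ℝ) ≤ n := by exact_mod_cast hn
  have hn0 : (0 : ℝ) < n := by linarith
  calc (n : ℝ) ^ t * (k : ℝ) ^ f ≤ (n : ℝ) ^ t * ((n : ℝ) ^ β) ^ f := by gcongr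
    _ = (n : ℝ) ^ ((t : ℝ) + β * f) := by
        rw [Real.rpow_add hn0, Real.rpow_natCast, Real.rpow_mul hn0.le, Real.rpow_natCast]
    _ ≤ _ := by
        refine Real.rpow_le_rpow_of_exponent_le hn' ?_
        have h' : 2 * (t : ℝ) + f + a ≤ 2 * k := by exact_mod_cast h
        have hfa' : (f : ℝ) ≤ a := by exact_mod_cast hfa
        nlinarith

lemma sum_factorial_card_add_le {n k f a : ℕ} {β : ℝ} (hn : 1 ≤ n) (hβ : 1 / 2 ≤ β)
    (hk : (k : ℝ) ≤ (n : ℝ) ^ β) (hfa : f ≤ a) :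
    ∑ T : Finset (Fin n), (if 2 * T.card + f + a ≤ 2 * k ∧ T.card + f ≤ k then
      ((T.card + f).factorial : ℝ) else 0) ≤ (k + 1) * (n : ℝ) ^ ((k : ℝ) - (1 - β) * a) := by
  have h := Finset.sum_powerset_apply_card (fun t => if 2 * t + f + a ≤ 2 * k ∧ t + f ≤ k then
      ((t + f).factorial : ℝ) else 0) (x := (Finset.univ : Finset (Fin n)))
  rw [Finset.powerset_univ, Finset.card_univ, Fintype.card_fin] at h
  rw [h]
  calc _ ≤ ∑ t ∈ Finset.range (n + 1),
        (if t ≤ k then (n : ℝ) ^ ((k : ℝ) - (1 - β) * a) else 0) := by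
        refine Finset.sum_le_sum fun t _ => ?_
        split_ifs with h1 h2 h2
        · rw [nsmul_eq_mul]
          refine le_trans ?_ (pow_mul_pow_le_rpow hn hβ hk hfa h1.1)
          have h3 : n.choose t * (t + f).factorial ≤ n ^ t * k ^ f :=
            (Nat.choose_mul_factorial_add_le n t f).trans
              (Nat.mul_le_mul_left _ (Nat.pow_le_pow_left h1.2 _))
          exact_mod_cast h3
        · omega
        · rw [smul_zero]
          positivity
        · simp
    _ ≤ _ := by
        rw [← Finset.sum_filter, Finset.sum_const, nsmul_eq_mul]
        refine mul_le_mul_of_nonneg_right ?_ (by positivity)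
        have : ((Finset.range (n + 1)).filter (· ≤ k)).card ≤ k + 1 := by
          rw [← Finset.card_range (k + 1)]
          refine Finset.card_le_card fun t ht => ?_
          exact Finset.mem_range_succ_iff.2 (Finset.mem_filter.1 ht).2
        exact_mod_cast this

namespace Equiv.Perm

/-- Checked point by point: a point where `w` agrees with neither `1` nor `u` counts twice on the
right, and any other point moved by `u` counts once. -/
lemma two_mul_card_add_card_support_le {α : Type*} [Fintype α] [DecidableEq α]
    (u w : Equiv.Perm α) :
    2 * (Finset.univ.filter fun i => i ∉ u.support ∧ w i ≠ i).card +
        (Finset.univ.filter fun i => i ∈ u.support ∧ w i ≠ i ∧ w i ≠ u i).card +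
        u.support.card ≤ w.support.card + hammingDist (⇑u) (⇑w) := by
  have h1 : w.support.card = ∑ i, if w i ≠ i then 1 else 0 := Finset.card_filter _ _
  have h2 : hammingDist (⇑u) (⇑w) = ∑ i, if u i ≠ w i then 1 else 0 := Finset.card_filter _ _
  have h3 : u.support.card = ∑ i, if u i ≠ i then 1 else 0 := Finset.card_filter _ _
  rw [h1, h2, h3, Finset.card_filter, Finset.card_filter, Finset.mul_sum,
    ← Finset.sum_add_distrib, ← Finset.sum_add_distrib, ← Finset.sum_add_distrib]
  refine Finset.sum_le_sum fun i _ => ?_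
  simp only [mem_support]
  by_cases a1 : u i = i
  · by_cases a2 : w i = i
    · simp [a1, a2]
    · simp [a1, a2, Ne.symm a2]
  · by_cases a2 : w i = i
    · simp [a1, a2]
    · by_cases a3 : w i = u i
      · simp [a1, a3]
      · simp [a1, a2, a3, Ne.symm a3]

/-- Triples `((F, A), T)`, where `F` and `A` are sets of points moved by `u` and `T` is a set of
points fixed by `u`, that may arise from a permutation `w` within distance `k` of `1` and `u`:
`T` and `F` hold the points at which `w` agrees with neither, and `A` those moved by `u` and
fixed by `w`. -/
def ballCodes {α : Type*} [Fintype α] [DecidableEq α] (k : ℕ) (u : Equiv.Perm α) :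
    Finset ((Finset α × Finset α) × Finset α) :=
  ((u.support.powerset ×ˢ u.support.powerset) ×ˢ (Finset.univ : Finset (Finset α))).filter
    fun q => 2 * q.2.card + q.1.1.card + u.support.card ≤ 2 * k ∧ q.2.card + q.1.1.card ≤ k

/-- Off `T ∪ F`, `w` agrees with `1` or `u`, and `A` records which at the points moved by `u`. -/
lemma inter_ball_subset_biUnion {α : Type*} [Fintype α] [DecidableEq α] (k : ℕ)
    (u : Equiv.Perm α) :
    (Finset.univ.filter fun w : Equiv.Perm α =>
      w.support.card ≤ k ∧ hammingDist (⇑u) (⇑w) ≤ k) ⊆ (ballCodes k u).biUnion fun q =>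
        Finset.univ.filter fun w : Equiv.Perm α =>
          ∀ i, i ∉ q.2 ∪ q.1.1 → w i = if i ∈ q.1.2 then i else u i := by
  intro w hw
  obtain ⟨hw1, hw2⟩ := (Finset.mem_filter.1 hw).2
  have h := two_mul_card_add_card_support_le u w
  rw [Finset.mem_biUnion]
  refine ⟨((Finset.univ.filter fun i => i ∈ u.support ∧ w i ≠ i ∧ w i ≠ u i,
    u.support.filter fun i => w i = i), Finset.univ.filter fun i => i ∉ u.support ∧ w i ≠ i),
    Finset.mem_filter.2 ⟨?_, ?_, ?_⟩, Finset.mem_filter.2 ⟨Finset.mem_univ _, ?_⟩⟩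
  · simp only [Finset.mem_product, Finset.mem_powerset, Finset.mem_univ, and_true]
    exact ⟨fun i hi => (Finset.mem_filter.1 hi).2.1, Finset.filter_subset _ _⟩
  · dsimp only
    omega
  · dsimp only
    rw [← Finset.card_union_of_disjoint (Finset.disjoint_left.2 fun i hi hi' =>
      (Finset.mem_filter.1 hi).2.1 (Finset.mem_filter.1 hi').2.1)]
    refine (Finset.card_le_card fun i hi => ?_).trans hw1
    rw [mem_support]
    rcases Finset.mem_union.1 hi with hi | hi
    · exact (Finset.mem_filter.1 hi).2.2
    · exact (Finset.mem_filter.1 hi).2.2.1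
  · intro i hi
    simp only [Finset.mem_union, Finset.mem_filter, Finset.mem_univ, true_and,
      mem_support] at hi ⊢
    by_cases a1 : u i = i
    · simp only [a1, ite_self]
      tauto
    · split_ifs with h
      · exact h.2
      · tauto

lemma card_inter_ball_le_sum {α : Type*} [Fintype α] [DecidableEq α] (k : ℕ)
    (u : Equiv.Perm α) :
    (Finset.univ.filter fun w : Equiv.Perm α =>
      w.support.card ≤ k ∧ hammingDist (⇑u) (⇑w) ≤ k).card ≤
      ∑ q ∈ ballCodes k u, (q.2.card + q.1.1.card).factorial :=
  ((Finset.card_le_card (inter_ball_subset_biUnion k u)).trans Finset.card_biUnion_le).trans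
    (Finset.sum_le_sum fun _ _ => (card_filter_agree_off_le _ _).trans
      (Nat.factorial_le (Finset.card_union_le _ _)))

end Equiv.Perm

open Equiv.Perm in
/-- The number of permutations within distance `k` of both `1` and `u`. -/
lemma card_inter_ball_le {n k : ℕ} {β : ℝ} (hn : 1 ≤ n) (hβ : 1 / 2 ≤ β)
    (hk : (k : ℝ) ≤ (n : ℝ) ^ β) (u : Equiv.Perm (Fin n)) (hu : u.support.card ≤ k) :
    ((Finset.univ.filter fun w : Equiv.Perm (Fin n) =>
      w.support.card ≤ k ∧ hammingDist (⇑u) (⇑w) ≤ k).card : ℝ) ≤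
      4 ^ k * ((k + 1) * (n : ℝ) ^ ((k : ℝ) - (1 - β) * u.support.card)) := by
  have h3 := card_inter_ball_le_sum k u
  set M := (k + 1) * (n : ℝ) ^ ((k : ℝ) - (1 - β) * u.support.card) with hM
  have hM0 : 0 ≤ M := by positivity
  calc _ ≤ ∑ q ∈ ballCodes k u, ((q.2.card + q.1.1.card).factorial : ℝ) := by
        exact_mod_cast h3
    _ = ∑ p ∈ u.support.powerset ×ˢ u.support.powerset, ∑ T : Finset (Fin n),
          (if 2 * T.card + p.1.card + u.support.card ≤ 2 * k ∧ T.card + p.1.card ≤ k then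
            ((T.card + p.1.card).factorial : ℝ) else 0) := by
        rw [ballCodes, Finset.sum_filter, Finset.sum_product]
    _ ≤ ∑ p ∈ u.support.powerset ×ˢ u.support.powerset, M :=
        Finset.sum_le_sum fun p hp => sum_factorial_card_add_le hn hβ hk
          (Finset.card_le_card (Finset.mem_powerset.1 (Finset.mem_product.1 hp).1))
    -- There are `2 ^ a` choices for each of `F` and `A`, where `a` is the support size of `u`.
    _ = 4 ^ u.support.card * M := by
        rw [Finset.sum_const, nsmul_eq_mul, Finset.card_product, Finset.card_powerset,
          ← mul_pow]
        norm_num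
    _ ≤ 4 ^ k * M :=
        mul_le_mul_of_nonneg_right (pow_le_pow_right₀ (by norm_num) hu) hM0

/-- The number of pairs of permutations that form with `1` a triple of diameter at most `k`. -/
lemma card_pairs_ball_le {n k : ℕ} {β : ℝ} (hn : 1 ≤ n) (hβ : 1 / 2 ≤ β)
    (hk : (k : ℝ) ≤ (n : ℝ) ^ β) :
    ((Finset.univ.filter fun p : Equiv.Perm (Fin n) × Equiv.Perm (Fin n) =>
      p.1.support.card ≤ k ∧ p.2.support.card ≤ k ∧ hammingDist (⇑p.1) (⇑p.2) ≤ k).card : ℝ) ≤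
      16 ^ k * (n : ℝ) ^ ((1 + β) * k) := by
  have hn' : (1 : ℝ) ≤ n := by exact_mod_cast hn
  have hn0 : (0 : ℝ) < n := by linarith
  have e1 : ((Finset.univ.filter fun p : Equiv.Perm (Fin n) × Equiv.Perm (Fin n) =>
      p.1.support.card ≤ k ∧ p.2.support.card ≤ k ∧
        hammingDist (⇑p.1) (⇑p.2) ≤ k).card : ℝ) =
      ∑ u ∈ Finset.univ.filter fun u : Equiv.Perm (Fin n) => u.support.card ≤ k,
        ((Finset.univ.filter fun w : Equiv.Perm (Fin n) =>
          w.support.card ≤ k ∧ hammingDist (⇑u) (⇑w) ≤ k).card : ℝ) := by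
    norm_cast
    rw [Finset.card_filter, ← Finset.univ_product_univ, Finset.sum_product, Finset.sum_filter]
    refine Finset.sum_congr rfl fun u _ => ?_
    split_ifs with h
    · rw [Finset.card_filter]
      simp only [h, true_and]
    · simp [h]
  rw [e1]
  have hmaps : ∀ u ∈ Finset.univ.filter fun u : Equiv.Perm (Fin n) => u.support.card ≤ k,
      u.support.card ∈ Finset.range (k + 1) := fun u hu =>
    Finset.mem_range_succ_iff.2 (Finset.mem_filter.1 hu).2
  set B := (n : ℝ) ^ ((1 + β) * k) with hB
  calc _ ≤ ∑ u ∈ Finset.univ.filter fun u : Equiv.Perm (Fin n) => u.support.card ≤ k,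
        4 ^ k * ((k + 1) * (n : ℝ) ^ ((k : ℝ) - (1 - β) * u.support.card)) :=
        Finset.sum_le_sum fun u hu => card_inter_ball_le hn hβ hk u (Finset.mem_filter.1 hu).2
    _ ≤ ∑ a ∈ Finset.range (k + 1), 4 ^ k * ((k + 1) * B) := by
        rw [← Finset.sum_fiberwise_of_maps_to hmaps]
        refine Finset.sum_le_sum fun a ha => ?_
        have ha : a ≤ k := Finset.mem_range_succ_iff.1 ha
        have ha' : (a : ℝ) ≤ k := by exact_mod_cast ha
        calc _ = ∑ u ∈ (Finset.univ.filter fun u : Equiv.Perm (Fin n) =>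
                u.support.card ≤ k).filter fun u => u.support.card = a,
              4 ^ k * ((k + 1) * (n : ℝ) ^ ((k : ℝ) - (1 - β) * a)) :=
              Finset.sum_congr rfl fun u hu => by rw [(Finset.mem_filter.1 hu).2]
          _ ≤ (n : ℝ) ^ a * (4 ^ k * ((k + 1) * (n : ℝ) ^ ((k : ℝ) - (1 - β) * a))) := by
              rw [Finset.sum_const, nsmul_eq_mul]
              refine mul_le_mul_of_nonneg_right ?_ (by positivity)
              have h1 := Equiv.Perm.card_filter_card_support_eq_le_pow (α := Fin n) a
              rw [Fintype.card_fin] at h1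
              have h2 : ((Finset.univ.filter fun u : Equiv.Perm (Fin n) =>
                u.support.card ≤ k).filter fun u => u.support.card = a).card ≤ n ^ a :=
                (Finset.card_le_card (Finset.filter_subset_filter _
                  (Finset.filter_subset _ _))).trans h1
              exact_mod_cast h2
          _ = 4 ^ k * ((k + 1) * (n : ℝ) ^ ((k : ℝ) + β * a)) := by
              have : (k : ℝ) + β * a = a + ((k : ℝ) - (1 - β) * a) := by ring
              rw [this, Real.rpow_add hn0, Real.rpow_natCast]
              ring
          _ ≤ _ := by
              rw [hB]
              gcongr
              nlinarith
    _ = 4 ^ k * ((k + 1) * (k + 1)) * B := by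
        rw [Finset.sum_const, nsmul_eq_mul, Finset.card_range]
        push_cast
        ring
    -- The polynomial factors are absorbed into the exponential.
    _ ≤ 4 ^ k * (2 ^ k * 2 ^ k) * B := by
        have : (k : ℝ) + 1 ≤ 2 ^ k := by exact_mod_cast Nat.lt_two_pow_self (n := k)
        gcongr
    _ = 16 ^ k * B := by
        rw [← mul_pow, ← mul_pow]
        norm_num

/-! ### Lower bound for the ball volume -/

/-- Factorials and derangement numbers obey the same recurrence `x (m + 2) = (m + 1) (x m + x (m +
1))`. The induction starts at `2` because `D_1 = 0`. -/
lemma factorial_le_three_mul_numDerangements (m : ℕ) :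
    (m + 2).factorial ≤ 3 * numDerangements (m + 2) := by
  induction m using Nat.twoStepInduction with
  | zero => decide
  | one => decide
  | more m h1 h2 =>
    have e1 : (m + 2 + 2).factorial =
        (m + 2 + 1) * ((m + 2).factorial + (m + 1 + 2).factorial) := by
      rw [Nat.factorial_succ (m + 3), show m + 1 + 2 = m + 2 + 1 from rfl,
        Nat.factorial_succ (m + 2)]
      ring
    rw [e1, numDerangements_add_two]
    calc _ ≤ (m + 2 + 1) * (3 * numDerangements (m + 2) + 3 * numDerangements (m + 1 + 2)) := by
          gcongr
      _ = _ := by ring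

lemma permBallVolume_pos (n r : ℕ) : 1 ≤ permBallVolume n r := by
  have := Finset.single_le_sum (f := fun i => n.choose i * numDerangements i)
    (fun i _ => Nat.zero_le _) (Finset.mem_range.2 (Nat.succ_pos r))
  simpa [permBallVolume] using this

/-- The top term alone is at least a third of the falling factorial, which is at least `(n / 2) ^
k`; the third is weakened to `3 ^ (-k)`. -/
lemma div_six_pow_le_permBallVolume {n k : ℕ} (hk : 2 ≤ k) (hkn : 2 * k ≤ n) :
    ((n : ℝ) / 6) ^ k ≤ permBallVolume n k := by
  have h1 : n.choose k * numDerangements k ≤ permBallVolume n k :=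
    Finset.single_le_sum (f := fun i => n.choose i * numDerangements i)
      (fun i _ => Nat.zero_le _) (Finset.mem_range.2 (Nat.lt_succ_self k))
  obtain ⟨m, rfl⟩ := Nat.exists_eq_add_of_le' hk
  have h2 : (n + 1 - (m + 2)) ^ (m + 2) ≤ 3 * permBallVolume n (m + 2) := by
    calc _ ≤ n.descFactorial (m + 2) := Nat.pow_sub_le_descFactorial _ _
      _ = n.choose (m + 2) * (m + 2).factorial := by
        rw [Nat.descFactorial_eq_factorial_mul_choose, mul_comm]
      _ ≤ n.choose (m + 2) * (3 * numDerangements (m + 2)) :=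
        Nat.mul_le_mul_left _ (factorial_le_three_mul_numDerangements m)
      _ ≤ 3 * permBallVolume n (m + 2) := by linarith
  have h3 : (n : ℝ) / 2 ≤ ((n + 1 - (m + 2) : ℕ) : ℝ) := by
    rw [div_le_iff₀ two_pos]
    norm_cast
    omega
  have h4 : ((n : ℝ) / 2) ^ (m + 2) ≤ 3 * permBallVolume n (m + 2) :=
    (pow_le_pow_left₀ (by positivity) h3 _).trans (by exact_mod_cast h2)
  have h5 : ((n : ℝ) / 6) ^ (m + 2) = ((n : ℝ) / 2) ^ (m + 2) / 3 ^ (m + 2) := by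
    rw [← div_pow]
    congr 1
    ring
  rw [h5, div_le_iff₀ (by positivity)]
  have h6 : (3 : ℝ) ≤ 3 ^ (m + 2) := le_self_pow₀ (by norm_num) (by omega)
  nlinarith [(Nat.cast_nonneg _ : (0 : ℝ) ≤ permBallVolume n (m + 2))]

lemma card_le_maxPermArray {n d : ℕ} {C : Finset (Equiv.Perm (Fin n))} (h : IsPermArray n d C) :
    C.card ≤ maxPermArray n d := by
  classical
  exact Finset.le_sup (f := Finset.card) (Finset.mem_filter.2 ⟨Finset.mem_univ C, h⟩)

lemma one_le_maxPermArray (n d : ℕ) : 1 ≤ maxPermArray n d := by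
  refine card_le_maxPermArray (C := {1}) fun x hx y hy hxy => ?_
  rw [Finset.mem_singleton] at hx hy
  exact absurd (hx.trans hy.symm) hxy

/-! ### The graph of close permutations and the final bound -/

namespace Equiv.Perm

variable {α : Type*} [Fintype α] [DecidableEq α]

lemma hammingDist_mul_left (x y z : Equiv.Perm α) :
    hammingDist (⇑(x * y)) (⇑(x * z)) = hammingDist (⇑y) (⇑z) :=
  hammingDist_comp (fun _ => ⇑x) (fun _ => x.injective)

lemma card_support_inv_mul (x y : Equiv.Perm α) :
    (x⁻¹ * y).support.card = hammingDist (⇑x) (⇑y) := by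
  rw [← hammingDist_mul_left x⁻¹ x y, inv_mul_cancel, hammingDist, support]
  refine congrArg Finset.card (Finset.filter_congr fun i _ => ?_)
  exact ne_comm

/-- The graph on permutations in which distinct ones at Hamming distance at most `k` are
adjacent. -/
def closeGraph (α : Type*) [Fintype α] [DecidableEq α] (k : ℕ) :
    SimpleGraph (Equiv.Perm α) where
  Adj x y := x ≠ y ∧ hammingDist (⇑x) (⇑y) ≤ k
  symm := ⟨fun x y h => ⟨h.1.symm, by rw [hammingDist_comm]; exact h.2⟩⟩
  loopless := ⟨fun x h => h.1 rfl⟩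

end Equiv.Perm

-- Left translation preserves Hamming distance, so degrees and triangles at any `v` can be counted
-- at `1`.
open Equiv.Perm in
lemma le_maxPermArray_of_pairs_le {n k : ℕ} {η : ℝ} (hη : 0 < η) (hη' : η ≤ 1 / 2)
    (hV : 1 < (permBallVolume n k : ℝ)) (hL : 4 ≤ η * Real.log (permBallVolume n k))
    (hp : ((Finset.univ.filter fun p : Equiv.Perm (Fin n) × Equiv.Perm (Fin n) =>
      p.1.support.card ≤ k ∧ p.2.support.card ≤ k ∧ hammingDist (⇑p.1) (⇑p.2) ≤ k).card : ℝ) ≤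
      (permBallVolume n k : ℝ) ^ (2 - 2 * η)) :
    n.factorial * (η * Real.log (permBallVolume n k)) / (32 * permBallVolume n k) ≤
      (maxPermArray n (k + 1) : ℝ) := by
  classical
  have key := SimpleGraph.exists_isIndepSet_of_locally_sparse (G := closeGraph (Fin n) k)
    hη hη' hV hL ?_ ?_
  · obtain ⟨I, hI, hc⟩ := key
    rw [Fintype.card_perm, Fintype.card_fin] at hc
    refine hc.trans ?_
    have : I.card ≤ maxPermArray n (k + 1) := card_le_maxPermArray fun x hx y hy hxy => by
      by_contra h
      exact hI hx hy hxy ⟨hxy, by omega⟩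
    exact_mod_cast this
  · intro v
    have h := card_filter_card_support_le_eq (α := Fin n) k
    rw [Fintype.card_fin] at h
    change _ = permBallVolume n k at h
    rw [← h]
    norm_cast
    refine Finset.card_le_card_of_injOn (fun y => v⁻¹ * y) ?_ (mul_right_injective _).injOn
    intro y hy
    have hy := (Finset.mem_filter.1 hy).2
    refine Finset.mem_coe.2 (Finset.mem_filter.2 ⟨Finset.mem_univ _, ?_⟩)
    rw [card_support_inv_mul]
    exact hy.2
  · intro v
    refine le_trans ?_ hp
    norm_cast
    refine Finset.card_le_card_of_injOn (fun p => (v⁻¹ * p.1, v⁻¹ * p.2)) ?_ ?_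
    · intro p hp
      have hp := (Finset.mem_filter.1 hp).2
      refine Finset.mem_coe.2 (Finset.mem_filter.2 ⟨Finset.mem_univ _, ?_⟩)
      rw [card_support_inv_mul, card_support_inv_mul, hammingDist_mul_left]
      exact ⟨hp.1.2, hp.2.1.2, hp.2.2.2⟩
    · intro p _ q _ h
      rw [Prod.mk.injEq, mul_right_inj, mul_right_inj] at h
      exact Prod.ext h.1 h.2

/-- For `η = (1 - β) / 4` the exponent `2 - 2η` exceeds `1 + β` by `(1 - β) / 2`. The surplus power
of `n` absorbs `576 = 16 * 36`, from `16 ^ k` in the pair count and the `6` in `(n / 6) ^ k`. -/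
lemma pairs_le_permBallVolume_rpow {n k : ℕ} {β : ℝ} (hn : 1 ≤ n) (hβ : 1 / 2 ≤ β) (hβ1 : β < 1)
    (hk : (k : ℝ) ≤ (n : ℝ) ^ β) (hk2 : 2 ≤ k) (hkn : 2 * k ≤ n)
    (hlarge : 576 ≤ (n : ℝ) ^ ((1 - β) / 2)) :
    ((Finset.univ.filter fun p : Equiv.Perm (Fin n) × Equiv.Perm (Fin n) =>
      p.1.support.card ≤ k ∧ p.2.support.card ≤ k ∧ hammingDist (⇑p.1) (⇑p.2) ≤ k).card : ℝ) ≤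
      (permBallVolume n k : ℝ) ^ (2 - 2 * ((1 - β) / 4)) := by
  have hn0 : (0 : ℝ) < n := by exact_mod_cast hn
  set s : ℝ := 2 - 2 * ((1 - β) / 4) with hs
  have hs0 : 0 ≤ s := by linarith
  have h6 : (6 : ℝ) ^ s ≤ 36 := by
    calc (6 : ℝ) ^ s ≤ 6 ^ (2 : ℝ) :=
          Real.rpow_le_rpow_of_exponent_le (by norm_num) (by linarith)
      _ = 36 := by norm_num
  have hbase : 16 * (n : ℝ) ^ (1 + β) ≤ ((n : ℝ) / 6) ^ s := by
    rw [Real.div_rpow hn0.le (by norm_num), le_div_iff₀ (by positivity)]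
    have e : s = (1 + β) + (1 - β) / 2 := by
      rw [hs]
      ring
    calc 16 * (n : ℝ) ^ (1 + β) * 6 ^ s ≤ 16 * (n : ℝ) ^ (1 + β) * 36 := by gcongr
      _ = (n : ℝ) ^ (1 + β) * 576 := by ring
      _ ≤ (n : ℝ) ^ (1 + β) * (n : ℝ) ^ ((1 - β) / 2) := by gcongr
      _ = (n : ℝ) ^ s := by rw [← Real.rpow_add hn0, ← e]
  calc _ ≤ 16 ^ k * (n : ℝ) ^ ((1 + β) * k) := card_pairs_ball_le hn hβ hk
    _ = (16 * (n : ℝ) ^ (1 + β)) ^ k := by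
        rw [mul_pow, Real.rpow_mul hn0.le, Real.rpow_natCast]
    _ ≤ (((n : ℝ) / 6) ^ s) ^ k := by gcongr
    _ = (((n : ℝ) / 6) ^ k) ^ s := by
        rw [← Real.rpow_natCast, ← Real.rpow_natCast, ← Real.rpow_mul (by positivity),
          ← Real.rpow_mul (by positivity), mul_comm]
    _ ≤ _ := Real.rpow_le_rpow (by positivity) (div_six_pow_le_permBallVolume hk2 hkn) hs0

open Filter in
lemma exists_threshold {α β η : ℝ} (hα0 : 0 < α) (hα1 : α < 1) (hβ1 : β < 1) :
    ∃ N : ℕ, ∀ n : ℕ, N ≤ n → 4 ≤ (n : ℝ) ^ α ∧ 2 * (n : ℝ) ^ α ≤ n ∧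
      576 ≤ (n : ℝ) ^ ((1 - β) / 2) ∧ 4 / η ≤ Real.log (n / 6) ∧ (6 : ℝ) < n := by
  have hT : Tendsto (fun n : ℕ => (n : ℝ)) atTop atTop := tendsto_natCast_atTop_atTop
  have hpow : ∀ y : ℝ, 0 < y → ∀ C : ℝ, ∀ᶠ n : ℕ in atTop, C ≤ (n : ℝ) ^ y := fun y hy C =>
    ((tendsto_rpow_atTop hy).comp hT).eventually_ge_atTop C
  have hlog : ∀ᶠ n : ℕ in atTop, 4 / η ≤ Real.log ((n : ℝ) / 6) :=
    (Real.tendsto_log_atTop.comp (hT.atTop_div_const (by norm_num))).eventually_ge_atTop _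
  have hall := (hpow α hα0 4).and ((hpow (1 - α) (by linarith) 2).and
    ((hpow ((1 - β) / 2) (by linarith) 576).and (hlog.and (hT.eventually_gt_atTop 6))))
  obtain ⟨N, hN⟩ := eventually_atTop.1 hall
  refine ⟨N, fun n hn => ?_⟩
  obtain ⟨h1, h2, h3, h4, h5⟩ := hN n hn
  refine ⟨h1, ?_, h3, h4, h5⟩
  have hn0 : (0 : ℝ) < n := by linarith
  calc 2 * (n : ℝ) ^ α ≤ (n : ℝ) ^ (1 - α) * (n : ℝ) ^ α := by gcongr
    _ = n := by
      rw [← Real.rpow_add hn0, sub_add_cancel, Real.rpow_one]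

theorem theorem3 (α : ℝ) (hα0 : 0 < α) (hα1 : α < 1) :
    ∃ c : ℝ, 0 < c ∧ ∀ n d : ℕ, 1 ≤ n →
      (d = ⌊(n : ℝ) ^ α⌋₊ ∨ d = ⌈(n : ℝ) ^ α⌉₊) →
      c * ((n.factorial : ℝ) / (permBallVolume n (d - 1) : ℝ)) *
          Real.logb 2 (permBallVolume n (d - 1) : ℝ)
        ≤ (maxPermArray n d : ℝ) := by
  -- The pair count needs `β ≥ 1 / 2`; enlarging the exponent only weakens `k ≤ n ^ α`.
  set β : ℝ := max α (1 / 2) with hβ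
  have hβ1 : β < 1 := max_lt hα1 (by norm_num)
  have hβ2 : 1 / 2 ≤ β := le_max_right _ _
  set η : ℝ := (1 - β) / 4 with hη
  have hη0 : 0 < η := by linarith
  obtain ⟨N, hN⟩ := exists_threshold (η := η) hα0 hα1 hβ1
  have hlog2 : 0 < Real.log 2 := Real.log_pos one_lt_two
  set c₁ : ℝ := η * Real.log 2 / 32 with hc₁
  -- For `n < N` a single permutation is enough, since `log v ≤ v` and `n! ≤ N!`.
  set c₂ : ℝ := Real.log 2 / N.factorial with hc₂
  have hc₁0 : 0 < c₁ := by positivity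
  have hc₂0 : 0 < c₂ := by positivity
  refine ⟨min c₁ c₂, lt_min hc₁0 hc₂0, fun n d hn hd => ?_⟩
  have hV1 : (1 : ℝ) ≤ permBallVolume n (d - 1) := by exact_mod_cast permBallVolume_pos _ _
  set v : ℝ := (permBallVolume n (d - 1) : ℝ) with hv
  have hv0 : 0 < v := by linarith
  have hlogv : 0 ≤ Real.log v := Real.log_nonneg hV1
  have hX : 0 ≤ (n.factorial : ℝ) / v * Real.logb 2 v := by
    rw [Real.logb]
    positivity
  rw [mul_assoc]
  rcases lt_or_ge n N with hnN | hnN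
  · calc min c₁ c₂ * ((n.factorial : ℝ) / v * Real.logb 2 v)
        ≤ c₂ * ((n.factorial : ℝ) / v * Real.logb 2 v) :=
          mul_le_mul_of_nonneg_right (min_le_right _ _) hX
      _ = (n.factorial / N.factorial) * (Real.log v / v) := by
          rw [hc₂, Real.logb]
          field_simp
      _ ≤ 1 * 1 := by
          gcongr
          · rw [div_le_one (by positivity)]
            exact_mod_cast Nat.factorial_le hnN.le
          · rw [div_le_one hv0]
            exact (Real.log_le_sub_one_of_pos hv0).trans (by linarith)
      _ ≤ maxPermArray n d := by
          rw [one_mul]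
          exact_mod_cast one_le_maxPermArray n d
  · obtain ⟨h4, h2, h576, hlog, h6⟩ := hN n hnN
    have hn0 : (0 : ℝ) < n := by linarith
    have hd4 : 4 ≤ d := by
      have hf : 4 ≤ ⌊(n : ℝ) ^ α⌋₊ := Nat.le_floor (by exact_mod_cast h4)
      rcases hd with rfl | rfl
      · exact hf
      · exact hf.trans (Nat.floor_le_ceil _)
    obtain ⟨k, rfl⟩ := Nat.exists_eq_add_of_le' (show 1 ≤ d by omega)
    rw [Nat.add_sub_cancel] at hv
    -- Since `k = d - 1`, this holds even when `d` is rounded up.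
    have hk : (k : ℝ) ≤ (n : ℝ) ^ α := by
      have : ((k + 1 : ℕ) : ℝ) < (n : ℝ) ^ α + 1 := by
        rcases hd with h | h
        · rw [h]
          linarith [Nat.floor_le (Real.rpow_nonneg hn0.le α)]
        · rw [h]
          exact Nat.ceil_lt_add_one (Real.rpow_nonneg hn0.le α)
      push_cast at this
      linarith
    have hkβ : (k : ℝ) ≤ (n : ℝ) ^ β :=
      hk.trans (Real.rpow_le_rpow_of_exponent_le (by linarith) (le_max_left _ _))
    have hk2 : 2 ≤ k := by omega
    have hkn : 2 * k ≤ n := by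
      have : 2 * (k : ℝ) ≤ n := by linarith
      exact_mod_cast this
    have hvn : (n : ℝ) / 6 ≤ v := by
      rw [hv]
      exact (le_self_pow₀ (by linarith) (by omega)).trans
        (div_six_pow_le_permBallVolume hk2 hkn)
    have hL : 4 ≤ η * Real.log v := by
      have := hlog.trans (Real.log_le_log (by positivity) hvn)
      rwa [div_le_iff₀' hη0] at this
    have hv1 : 1 < v := by linarith
    have hmain := le_maxPermArray_of_pairs_le (n := n) (k := k) hη0 (by linarith)
      (hv ▸ hv1) (hv ▸ hL)
      (pairs_le_permBallVolume_rpow hn hβ2 hβ1 hkβ hk2 hkn h576)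
    rw [← hv] at hmain
    calc min c₁ c₂ * ((n.factorial : ℝ) / v * Real.logb 2 v)
        ≤ c₁ * ((n.factorial : ℝ) / v * Real.logb 2 v) :=
          mul_le_mul_of_nonneg_right (min_le_left _ _) hX
      _ = n.factorial * (η * Real.log v) / (32 * v) := by
          rw [hc₁, Real.logb]
          field_simp
      _ ≤ _ := hmain
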